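/- Let $\mathcal I\subset[0,\infty)$ be compact, let $C^0(\mathcal I)$ be the space of continuous functions $\mathcal I\to\mathbb R$ with the topology of uniform convergence, and let $\mathcal C\subset C^0(\mathcal I)$ be compact. A functional $F:\mathcal I\times\mathcal C\to\mathbb R$ (written $y(t)=F(t,u)$) is called causal if $F(t,u)=F(t,v)$ whenever $t\in\mathcal I$ and $u,v\in\mathcal C$ satisfy $u(\tau)=v(\tau)$ for all $\tau\in\mathcal I$ with $0\le\tau\le t$. Let $\mathfrak S$ be the $\mathbb R$-algebra of continuous causal functionals $\mathcal I\times\mathcal C\to\mathbb R$, with the topology of uniform convergence. Let $J$ be the convex hull of $\mathcal I$ (so $J=\mathcal I$ if $\mathcal I$ is an interval). Let $\mathfrak A\subset\mathfrak S$ be the set of those $F$ that satisfy an algebraic differential equation $$E(y,\dot y,\dots,y^{(a)},u,\dot u,\dots,u^{(b)})=0 ,$$ that is, for which there are integers $a,b\ge 0$ and one polynomial $E$ with real coefficients in $(a+1)+(b+1)$ variables such that for every $u\in\mathcal C$ there are functions $\hat y\in C^a(\mathbb R)$ and $\hat u\in C^b(\mathbb R)$, with $\hat y(t)=F(t,u)$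 and $\hat u(t)=u(t)$ for all $t\in\mathcal I$, satisfying * $E(\hat y(t),\dots,\hat y^{(a)}(t),\hat u(t),\dots,\hat u^{(b)}(t))=0$ for every $t\in J$; * the equation is nontrivial in $y$: the set of $t\in J$ for which $E(Y_0,\dots,Y_a,\hat u(t),\dots,\hat u^{(b)}(t))$ is not the zero polynomial in $Y_0,\dots,Y_a$ is dense in $J$. (If $\mathcal I$ is a nondegenerate interval, this says that each $u\in\mathcal C$ is of class $C^b$ on $\mathcal I$, that $t\mapsto F(t,u)$ is of class $C^a$ on $\mathcal I$, and that the pair is a classical solution of a nontrivial equation.) Then $\mathfrak A$ is dense in $\mathfrak S$: for every $F\in\mathfrak S$ and every $\varepsilon>0$ there is $G\in\mathfrak A$ with $|F(t,u)-G(t,u)|<\varepsilon$ for all $(t,u)\in\mathcal I\times\mathcal C$. -/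

import Mathlib

/-- A functional `y(t) = F(t, u)`, defined for times `t ∈ I` and inputs `u ∈ C`, is causal
(non-anticipative) if `F(t, u)` depends only on the values of `u` at the times `τ ∈ I`, `τ ≤ t`. -/
def IsCausal {I : Set ℝ} {C : Set C(I, ℝ)} (F : I × C → ℝ) : Prop :=
  ∀ (t : I) (u v : C), (∀ τ : I, τ ≤ t → u.1 τ = v.1 τ) → F (t, u) = F (t, v)

/-- The real algebra `𝔖` of continuous causal functionals `I × C → ℝ`, as a subalgebra of
`C(I × C, ℝ)`. The topology is the compact-open one, i.e. that of uniform convergence whenever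
`I` and `C` are compact. -/
def causalFunctionals (I : Set ℝ) (C : Set C(I, ℝ)) : Subalgebra ℝ C(I × C, ℝ) where
  carrier := {F | IsCausal F}
  mul_mem' := by
    intro F G hF hG t u v h
    simp [hF t u v h, hG t u v h]
  add_mem' := by
    intro F G hF hG t u v h
    simp [hF t u v h, hG t u v h]
  algebraMap_mem' := by
    intro r t u v _
    simp

/-- Polynomials `E(y, ẏ, …, y^(a), u, u̇, …, u^(b))` with real coefficients. -/
abbrev DiffPoly (a b : ℕ) : Type := MvPolynomial (Fin (a + 1) ⊕ Fin (b + 1)) ℝ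

/-- The number `E(y(t), …, y^(a)(t), u(t), …, u^(b)(t))`. -/
noncomputable def DiffPoly.evalAt {a b : ℕ} (E : DiffPoly a b) (y u : ℝ → ℝ) (t : ℝ) : ℝ :=
  MvPolynomial.eval
    (Sum.elim (fun i : Fin (a + 1) => iteratedDeriv i y t)
      (fun j : Fin (b + 1) => iteratedDeriv j u t)) E

/-- The polynomial `E(Y₀, …, Y_a, u(t), …, u^(b)(t))` in the unknowns `Y₀, …, Y_a`, obtained by
substituting only the values of the input and of its derivatives at time `t`. -/
noncomputable def DiffPoly.specialize {a b : ℕ} (E : DiffPoly a b) (u : ℝ → ℝ) (t : ℝ) :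
    MvPolynomial (Fin (a + 1)) ℝ :=
  MvPolynomial.aeval
    (Sum.elim (fun i : Fin (a + 1) => (MvPolynomial.X i : MvPolynomial (Fin (a + 1)) ℝ))
      (fun j : Fin (b + 1) => MvPolynomial.C (iteratedDeriv j u t))) E

/-- `(u, y)` is a classical trajectory of `E(y, …, y^(a), u, …, u^(b)) = 0` on `J`: `y` is of
class `C^a`, `u` is of class `C^b`, the equation holds at all times of `J`, and it is a nontrivial
equation for `y`, in that the coefficients of `E`, seen as a polynomial in `y, …, y^(a)`,
do not all vanish identically along `u` on a nonempty relatively open subset of `J`. -/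
structure DiffPoly.IsTrajectory {a b : ℕ} (E : DiffPoly a b) (J : Set ℝ) (y u : ℝ → ℝ) :
    Prop where
  contDiff_output : ContDiff ℝ a y
  contDiff_input : ContDiff ℝ b u
  equation : ∀ t ∈ J, E.evalAt y u t = 0
  nontrivial : J ⊆ closure {t ∈ J | E.specialize u t ≠ 0}

/-- `F` satisfies an algebraic differential equation: there is one polynomial `E` such that, for
every input `u ∈ C`, the pair `(u, F(·, u))` is the restriction to `I` of a trajectory of `E = 0`
on the smallest interval containing `I`. If `I` is itself a nondegenerate interval, then the
derivatives at the times of `I` are just the (at the end points one-sided) derivatives of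
`F(·, u)` and `u`; otherwise this gives them a meaning. -/
def IsDiffAlgebraic {I : Set ℝ} {C : Set C(I, ℝ)} (F : I × C → ℝ) : Prop :=
  ∃ (a b : ℕ) (E : DiffPoly a b), ∀ u : C, ∃ yExt uExt : ℝ → ℝ,
    (∀ t : I, yExt t = F (t, u)) ∧ (∀ t : I, uExt t = u.1 t) ∧
      E.IsTrajectory (convexHull ℝ I) yExt uExt

/-- The set `𝔄 ⊆ 𝔖` of the continuous causal functionals that satisfy an algebraic differential
equation. -/
def diffAlgebraicFunctionals (I : Set ℝ) (C : Set C(I, ℝ)) : Set (causalFunctionals I C) :=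
  {F | IsDiffAlgebraic (F.1 : I × C → ℝ)}

open Filter Topology Real

/-! Sample `F(·, u)` on a grid of step `1/N` and join the samples by smooth transitions, delayed by
one step so that only past samples enter; uniform continuity of `F` makes the error small. On each
cell the derivative of the interpolant is `c * sin (ω t) ^ 4`, with `c` depending on the cell and on
`u`. The equation of `sineEquation` is homogeneous in `y` and holds for every `c`, so one polynomial
serves all inputs. The constant `c` changes only at zeros of the sine, where the fourth power keeps
the interpolant of class `C³` (`hasDerivAt_mul_of_locally_const`). -/

/-- If `c` is bounded and `f` vanishes to second order wherever `c` fails to be locally constant,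
then `c * f` is differentiable with the expected derivative. -/
theorem hasDerivAt_mul_of_locally_const {c f : ℝ → ℝ} {f' x M : ℝ} (hc : ∀ z, |c z| ≤ M)
    (hf : HasDerivAt f f' x) (h : (f x = 0 ∧ f' = 0) ∨ c =ᶠ[𝓝 x] fun _ => c x) :
    HasDerivAt (fun z => c z * f z) (c x * f') x := by
  rcases h with ⟨h0, rfl⟩ | h
  · rw [hasDerivAt_iff_isLittleO] at hf ⊢
    simp only [h0, sub_zero, smul_zero, mul_zero] at hf ⊢
    refine Asymptotics.IsBigO.trans_isLittleO ?_ hf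
    refine Asymptotics.IsBigO.of_bound M (Eventually.of_forall fun z => ?_)
    rw [norm_mul]
    exact mul_le_mul_of_nonneg_right (hc z) (norm_nonneg _)
  · refine (hf.const_mul (c x)).congr_of_eventuallyEq ?_
    filter_upwards [h] with z hz
    rw [hz]

/-! ### The sine transition -/

/-- The indicator function of `[0, ∞)`. -/
noncomputable def unitStep (x : ℝ) : ℝ := if 0 ≤ x then 1 else 0

theorem unitStep_of_nonneg {x : ℝ} (h : 0 ≤ x) : unitStep x = 1 := if_pos h

theorem unitStep_of_neg {x : ℝ} (h : x < 0) : unitStep x = 0 := if_neg (not_le.2 h)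

theorem abs_unitStep_le (x : ℝ) : |unitStep x| ≤ 1 := by
  unfold unitStep; split_ifs <;> simp

theorem unitStep_eventuallyEq {x : ℝ} (h : x ≠ 0) : unitStep =ᶠ[𝓝 x] fun _ => unitStep x := by
  rcases h.lt_or_gt with h | h
  · filter_upwards [Iio_mem_nhds h] with z hz
    rw [unitStep_of_neg h, unitStep_of_neg hz]
  · filter_upwards [Ioi_mem_nhds h] with z hz
    rw [unitStep_of_nonneg h.le, unitStep_of_nonneg (le_of_lt hz)]

/-- The primitive of `8 / 3 * sin (π x) ^ 4` that vanishes at `0`; it fixes the integers. -/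
noncomputable def sinFourPrimitive (x : ℝ) : ℝ :=
  x - (sin (π * x) * cos (π * x) + 2 / 3 * (sin (π * x) ^ 3 * cos (π * x))) / π

theorem hasDerivAt_sin_pi_mul (x : ℝ) : HasDerivAt (fun z => sin (π * z)) (π * cos (π * x)) x := by
  simpa [mul_comm] using ((hasDerivAt_id x).const_mul π).sin

theorem hasDerivAt_cos_pi_mul (x : ℝ) :
    HasDerivAt (fun z => cos (π * z)) (-(π * sin (π * x))) x := by
  simpa [mul_comm] using ((hasDerivAt_id x).const_mul π).cos

theorem hasDerivAt_sinFourPrimitive (x : ℝ) :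
    HasDerivAt sinFourPrimitive (8 / 3 * sin (π * x) ^ 4) x := by
  have hs := hasDerivAt_sin_pi_mul x
  have hc := hasDerivAt_cos_pi_mul x
  have h := (hasDerivAt_id x).sub
    (((hs.mul hc).add (((hs.pow 3).mul hc).const_mul (2 / 3))).div_const π)
  refine h.congr_deriv ?_
  have hsc := sin_sq_add_cos_sq (π * x)
  have hπ := pi_ne_zero
  simp
  field_simp
  have : cos (π * x) ^ 2 = 1 - sin (π * x) ^ 2 := by linarith
  ring_nf
  rw [this]
  ring

theorem sinFourPrimitive_zero : sinFourPrimitive 0 = 0 := by simp [sinFourPrimitive]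

theorem sinFourPrimitive_sub_one (x : ℝ) : sinFourPrimitive (x - 1) = sinFourPrimitive x - 1 := by
  simp only [sinFourPrimitive, mul_sub, mul_one, sin_sub_pi, cos_sub_pi]
  ring

/-- The factor `8 / 3` is the inverse of the mean of `sin ^ 4`. -/
theorem sinFourPrimitive_one : sinFourPrimitive 1 = 1 := by
  have := sinFourPrimitive_sub_one 1
  rw [sub_self, sinFourPrimitive_zero] at this
  linarith

theorem monotone_sinFourPrimitive : Monotone sinFourPrimitive :=
  monotone_of_hasDerivAt_nonneg hasDerivAt_sinFourPrimitive fun x => by positivity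

/-- A transition of class `C⁴` from `0` on `(-∞, 0]` to `1` on `[1, ∞)`, with derivative
`8 / 3 * sin (π x) ^ 4` in between. -/
noncomputable def sineTransition (x : ℝ) : ℝ :=
  unitStep x * sinFourPrimitive x - unitStep (x - 1) * sinFourPrimitive (x - 1)

theorem sineTransition_of_nonpos {x : ℝ} (h : x ≤ 0) : sineTransition x = 0 := by
  rw [sineTransition, unitStep_of_neg (x := x - 1) (by linarith)]
  rcases h.lt_or_eq with h | rfl
  · simp [unitStep_of_neg h]
  · simp [sinFourPrimitive_zero]

theorem sineTransition_of_one_le {x : ℝ} (h : 1 ≤ x) : sineTransition x = 1 := by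
  rw [sineTransition, unitStep_of_nonneg (by linarith), unitStep_of_nonneg (by linarith),
    sinFourPrimitive_sub_one]
  ring

theorem sineTransition_mem_Icc (x : ℝ) : sineTransition x ∈ Set.Icc 0 1 := by
  rcases le_or_gt x 0 with h | h
  · simp [sineTransition_of_nonpos h]
  rcases le_or_gt 1 x with h' | h'
  · simp [sineTransition_of_one_le h']
  rw [sineTransition, unitStep_of_neg (x := x - 1) (by linarith), unitStep_of_nonneg h.le, one_mul,
    zero_mul, sub_zero]
  refine ⟨?_, ?_⟩
  · simpa [sinFourPrimitive_zero] using monotone_sinFourPrimitive h.le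
  · simpa [sinFourPrimitive_one] using monotone_sinFourPrimitive h'.le

theorem hasDerivAt_unitStep_mul_sinFourPrimitive (x : ℝ) :
    HasDerivAt (fun z => unitStep z * sinFourPrimitive z)
      (unitStep x * (8 / 3 * sin (π * x) ^ 4)) x := by
  refine hasDerivAt_mul_of_locally_const abs_unitStep_le (hasDerivAt_sinFourPrimitive x) ?_
  by_cases h : x = 0
  · subst h
    simp [sinFourPrimitive_zero]
  · exact Or.inr (unitStep_eventuallyEq h)

theorem hasDerivAt_sineTransition (x : ℝ) :
    HasDerivAt sineTransition
      ((unitStep x - unitStep (x - 1)) * (8 / 3 * sin (π * x) ^ 4)) x := by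
  have h1 := hasDerivAt_unitStep_mul_sinFourPrimitive x
  have h2 := (hasDerivAt_unitStep_mul_sinFourPrimitive (x - 1)).comp_sub_const x 1
  refine (h1.sub h2).congr_deriv ?_
  simp only [mul_sub, mul_one, sin_sub_pi]
  ring

theorem continuous_sineTransition : Continuous sineTransition :=
  continuous_iff_continuousAt.2 fun x => (hasDerivAt_sineTransition x).continuousAt

/-! ### Interpolation of a sequence -/

/-- The function with value `a 0` at `0`, value `a i` at `i ≤ n`, and a `sineTransition` in
between. -/
noncomputable def sineInterpolation (n : ℕ) (a : ℕ → ℝ) (x : ℝ) : ℝ :=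
  a 0 + ∑ i ∈ Finset.range n, (a (i + 1) - a i) * sineTransition (x - i)

/-- The increment of `sineInterpolation n a` over the unit cell of `x`. -/
noncomputable def cellIncrement (n : ℕ) (a : ℕ → ℝ) (x : ℝ) : ℝ :=
  ∑ i ∈ Finset.range n, (a (i + 1) - a i) * (unitStep (x - i) - unitStep (x - i - 1))

theorem hasDerivAt_sineInterpolation (n : ℕ) (a : ℕ → ℝ) (x : ℝ) :
    HasDerivAt (sineInterpolation n a) (cellIncrement n a x * (8 / 3 * sin (π * x) ^ 4)) x := by
  have h : HasDerivAt (sineInterpolation n a)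
      (∑ i ∈ Finset.range n, (a (i + 1) - a i) *
        ((unitStep (x - i) - unitStep (x - i - 1)) * (8 / 3 * sin (π * (x - i)) ^ 4))) x := by
    refine (HasDerivAt.fun_sum fun (i : ℕ) _ => ?_).const_add (a 0)
    exact ((hasDerivAt_sineTransition (x - i)).comp_sub_const x (i : ℝ)).const_mul _
  refine h.congr_deriv ?_
  rw [cellIncrement, Finset.sum_mul]
  refine Finset.sum_congr rfl fun i _ => ?_
  -- The even exponent removes the sign `(-1) ^ i`, so all cells share one profile.
  have : sin (π * (x - i)) ^ 4 = sin (π * x) ^ 4 := by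
    rw [mul_sub, mul_comm π (i : ℝ), sin_sub_nat_mul_pi, mul_pow, ← pow_mul,
      (Even.mul_left (by decide) i : Even (i * 4)).neg_one_pow, one_mul]
  rw [this, mul_assoc]

theorem abs_cellIncrement_le (n : ℕ) (a : ℕ → ℝ) (x : ℝ) :
    |cellIncrement n a x| ≤ ∑ i ∈ Finset.range n, |a (i + 1) - a i| * 2 := by
  refine (Finset.abs_sum_le_sum_abs _ _).trans (Finset.sum_le_sum fun i _ => ?_)
  rw [abs_mul]
  refine mul_le_mul_of_nonneg_left ((abs_sub _ _).trans ?_) (abs_nonneg _)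
  linarith [abs_unitStep_le (x - i), abs_unitStep_le (x - i - 1)]

/-- The increment can jump only at integers, which are zeros of `sin (π * x)`. -/
theorem cellIncrement_eventuallyEq (n : ℕ) (a : ℕ → ℝ) {x : ℝ} (h : sin (π * x) ≠ 0) :
    cellIncrement n a =ᶠ[𝓝 x] fun _ => cellIncrement n a x := by
  have key (i : ℕ) : ∀ᶠ z in 𝓝 x, unitStep (z - i) = unitStep (x - i) := by
    have hx : x - i ≠ 0 := by
      intro hx
      apply h
      rw [sub_eq_zero.1 hx, mul_comm, sin_nat_mul_pi]
    have ht : Tendsto (fun z : ℝ => z - i) (𝓝 x) (𝓝 (x - i)) :=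
      (continuous_id.sub continuous_const).tendsto x
    exact ht.eventually (unitStep_eventuallyEq hx)
  have : ∀ᶠ z in 𝓝 x, ∀ i ∈ Finset.range n, unitStep (z - i) = unitStep (x - i) ∧
      unitStep (z - i - 1) = unitStep (x - i - 1) := by
    rw [Filter.eventually_all_finset]
    intro i _
    filter_upwards [key i, key (i + 1)] with z h1 h2
    refine ⟨h1, ?_⟩
    push_cast at h2
    rw [sub_sub, sub_sub, h2]
  filter_upwards [this] with z hz
  refine Finset.sum_congr rfl fun i hi => ?_
  rw [(hz i hi).1, (hz i hi).2]

theorem hasDerivAt_cellIncrement_mul (n : ℕ) (a : ℕ → ℝ) {f : ℝ → ℝ} {f' x : ℝ}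
    (hf : HasDerivAt f f' x) (h0 : sin (π * x) = 0 → f x = 0 ∧ f' = 0) :
    HasDerivAt (fun z => cellIncrement n a z * f z) (cellIncrement n a x * f') x :=
  hasDerivAt_mul_of_locally_const (abs_cellIncrement_le n a) hf <| by
    by_cases h : sin (π * x) = 0
    · exact Or.inl (h0 h)
    · exact Or.inr (cellIncrement_eventuallyEq n a h)

theorem iteratedDeriv_one_sineInterpolation (n : ℕ) (a : ℕ → ℝ) :
    iteratedDeriv 1 (sineInterpolation n a) =
      fun x => cellIncrement n a x * (8 / 3 * sin (π * x) ^ 4) := by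
  rw [iteratedDeriv_one]
  exact funext fun x => (hasDerivAt_sineInterpolation n a x).deriv

theorem hasDerivAt_cellIncrement_mul_sin_pow_four (n : ℕ) (a : ℕ → ℝ) (x : ℝ) :
    HasDerivAt (fun x => cellIncrement n a x * (8 / 3 * sin (π * x) ^ 4))
      (cellIncrement n a x * (32 / 3 * π * (sin (π * x) ^ 3 * cos (π * x)))) x := by
  refine hasDerivAt_cellIncrement_mul n a ?_ fun h => by simp [h]
  refine (((hasDerivAt_sin_pi_mul x).pow 4).const_mul (8 / 3)).congr_deriv ?_
  simp
  ring

theorem iteratedDeriv_two_sineInterpolation (n : ℕ) (a : ℕ → ℝ) :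
    iteratedDeriv 2 (sineInterpolation n a) =
      fun x => cellIncrement n a x * (32 / 3 * π * (sin (π * x) ^ 3 * cos (π * x))) := by
  rw [iteratedDeriv_succ, iteratedDeriv_one_sineInterpolation]
  exact funext fun x => (hasDerivAt_cellIncrement_mul_sin_pow_four n a x).deriv

theorem hasDerivAt_cellIncrement_mul_sin_pow_three (n : ℕ) (a : ℕ → ℝ) (x : ℝ) :
    HasDerivAt (fun x => cellIncrement n a x * (32 / 3 * π * (sin (π * x) ^ 3 * cos (π * x))))
      (cellIncrement n a x * (32 / 3 * π ^ 2 *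
        (3 * sin (π * x) ^ 2 * cos (π * x) ^ 2 - sin (π * x) ^ 4))) x := by
  refine hasDerivAt_cellIncrement_mul n a ?_ fun h => by simp [h]
  refine ((((hasDerivAt_sin_pi_mul x).pow 3).mul (hasDerivAt_cos_pi_mul x)).const_mul
    (32 / 3 * π)).congr_deriv ?_
  simp
  ring

theorem iteratedDeriv_three_sineInterpolation (n : ℕ) (a : ℕ → ℝ) :
    iteratedDeriv 3 (sineInterpolation n a) = fun x => cellIncrement n a x * (32 / 3 * π ^ 2 *
        (3 * sin (π * x) ^ 2 * cos (π * x) ^ 2 - sin (π * x) ^ 4)) := by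
  rw [iteratedDeriv_succ, iteratedDeriv_two_sineInterpolation]
  exact funext fun x => (hasDerivAt_cellIncrement_mul_sin_pow_three n a x).deriv

theorem contDiff_sineInterpolation (n : ℕ) (a : ℕ → ℝ) :
    ContDiff ℝ 3 (sineInterpolation n a) := by
  refine contDiff_of_differentiable_iteratedDeriv (n := 3) fun m hm x => ?_
  have hm' : m ≤ 3 := by exact_mod_cast hm
  interval_cases m
  · rw [iteratedDeriv_zero]
    exact (hasDerivAt_sineInterpolation n a x).differentiableAt
  · rw [iteratedDeriv_one_sineInterpolation]
    exact (hasDerivAt_cellIncrement_mul_sin_pow_four n a x).differentiableAt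
  · rw [iteratedDeriv_two_sineInterpolation]
    exact (hasDerivAt_cellIncrement_mul_sin_pow_three n a x).differentiableAt
  · rw [iteratedDeriv_three_sineInterpolation]
    have hs := hasDerivAt_sin_pi_mul x
    have hc := hasDerivAt_cos_pi_mul x
    exact (hasDerivAt_cellIncrement_mul n a (((((hs.pow 2).const_mul 3).mul (hc.pow 2)).sub
      (hs.pow 4)).const_mul (32 / 3 * π ^ 2)) fun h => by simp [h]).differentiableAt

/-- Every term is quadratic in the increment, which factors out; what remains is an identity for
`sin ^ 4`. -/
theorem iteratedDeriv_sineInterpolation_equation (n : ℕ) (a : ℕ → ℝ) (x : ℝ) :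
    4 * iteratedDeriv 1 (sineInterpolation n a) x * iteratedDeriv 3 (sineInterpolation n a) x
      - 3 * iteratedDeriv 2 (sineInterpolation n a) x ^ 2
      + 16 * π ^ 2 * iteratedDeriv 1 (sineInterpolation n a) x ^ 2 = 0 := by
  rw [iteratedDeriv_one_sineInterpolation, iteratedDeriv_two_sineInterpolation,
    iteratedDeriv_three_sineInterpolation]
  ring

theorem sineInterpolation_eq (n : ℕ) (a : ℕ → ℝ) {x : ℝ} {k : ℕ} (hk : k < n)
    (hx : (k : ℝ) ≤ x) (hx' : x ≤ k + 1) :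
    sineInterpolation n a x = a k + (a (k + 1) - a k) * sineTransition (x - k) := by
  have h1 : ∑ i ∈ Finset.range n, (a (i + 1) - a i) * sineTransition (x - i) =
      ∑ i ∈ Finset.range (k + 1), (a (i + 1) - a i) * sineTransition (x - i) := by
    symm
    refine Finset.sum_subset (by simpa using hk) fun i _ hi => ?_
    have : ((k + 1 : ℕ) : ℝ) ≤ i := by exact_mod_cast not_lt.1 (by simpa using hi)
    push_cast at this
    rw [sineTransition_of_nonpos (by linarith), mul_zero]
  have h2 : ∑ i ∈ Finset.range k, (a (i + 1) - a i) * sineTransition (x - i) =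
      ∑ i ∈ Finset.range k, (a (i + 1) - a i) := by
    refine Finset.sum_congr rfl fun i hi => ?_
    have : ((i + 1 : ℕ) : ℝ) ≤ k := by exact_mod_cast Finset.mem_range.1 hi
    push_cast at this
    rw [sineTransition_of_one_le (by linarith), mul_one]
  rw [sineInterpolation, h1, Finset.sum_range_succ, h2, Finset.sum_range_sub]
  ring

/-! ### The differential equation -/

/-- The equation `4 y' y''' - 3 y''² + 16 ω² y'² = 0`. -/
noncomputable def sineEquation (ω : ℝ) : DiffPoly 3 0 :=
  4 * MvPolynomial.X (Sum.inl 1) * MvPolynomial.X (Sum.inl 3)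
    - 3 * MvPolynomial.X (Sum.inl 2) ^ 2
    + MvPolynomial.C (16 * ω ^ 2) * MvPolynomial.X (Sum.inl 1) ^ 2

theorem evalAt_sineEquation (ω : ℝ) (y u : ℝ → ℝ) (t : ℝ) :
    (sineEquation ω).evalAt y u t =
      4 * iteratedDeriv 1 y t * iteratedDeriv 3 y t - 3 * iteratedDeriv 2 y t ^ 2
        + 16 * ω ^ 2 * iteratedDeriv 1 y t ^ 2 := by
  simp [DiffPoly.evalAt, sineEquation]

theorem specialize_sineEquation_ne_zero {ω : ℝ} (hω : ω ≠ 0) (u : ℝ → ℝ) (t : ℝ) :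
    (sineEquation ω).specialize u t ≠ 0 := by
  intro h
  -- At `Y₁ = 1` and all other unknowns `0`, only `16 * ω ^ 2` survives.
  have := congrArg (MvPolynomial.eval fun i : Fin 4 => if i = 1 then (1 : ℝ) else 0) h
  simp [DiffPoly.specialize, sineEquation, hω] at this

theorem isTrajectory_sineEquation {δ : ℝ} (hδ : δ ≠ 0) (n : ℕ) (a : ℕ → ℝ) (J : Set ℝ)
    {u : ℝ → ℝ} (hu : Continuous u) :
    (sineEquation (δ * π)).IsTrajectory J (fun t => sineInterpolation n a (δ * t)) u where
  contDiff_output := (contDiff_sineInterpolation n a).comp (contDiff_const.mul contDiff_id)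
  contDiff_input := contDiff_zero.2 hu
  equation t _ := by
    have h := contDiff_sineInterpolation n a
    rw [evalAt_sineEquation, iteratedDeriv_comp_const_mul (h.of_le (by norm_num)) δ,
      iteratedDeriv_comp_const_mul (h.of_le (by norm_num)) δ,
      iteratedDeriv_comp_const_mul (h.of_le (by norm_num)) δ]
    have := iteratedDeriv_sineInterpolation_equation n a (δ * t)
    simp only
    -- Each term scales by `δ ^ 4`, counting the `δ ^ 2` inside the coefficient.
    linear_combination δ ^ 4 * this
  nontrivial := by
    simp only [ne_eq, specialize_sineEquation_ne_zero (mul_ne_zero hδ pi_ne_zero),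
      not_false_eq_true, and_true]
    exact subset_closure

/-! ### Sampling and density -/

/-- In a nonempty compact set, every real number has a best upper neighbour, if any. -/
theorem exists_next_mem {I : Set ℝ} (hI : IsCompact I) (hne : I.Nonempty) (r : ℝ) :
    ∃ s : I, ∀ t : I, r ≤ t → r ≤ s ∧ s ≤ t := by
  by_cases h : (I ∩ Set.Ici r).Nonempty
  · obtain ⟨s, hs, hmin⟩ := (hI.inter_right isClosed_Ici).exists_isLeast h
    exact ⟨⟨s, hs.1⟩, fun t ht => ⟨hs.2, hmin ⟨t.2, ht⟩⟩⟩
  · obtain ⟨s, hs⟩ := hne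
    exact ⟨⟨s, hs⟩, fun t ht => (h ⟨t, t.2, ht⟩).elim⟩

theorem mainTheorem1 (I : Set ℝ) (hI : IsCompact I) (hI0 : I ⊆ Set.Ici 0)
    (C : Set C(I, ℝ)) (hC : IsCompact C) :
    Dense (diffAlgebraicFunctionals I C) := by
  have : CompactSpace I := isCompact_iff_compactSpace.1 hI
  have : CompactSpace C := isCompact_iff_compactSpace.1 hC
  rcases I.eq_empty_or_nonempty with rfl | hne
  · intro F
    refine subset_closure ⟨0, 0, 0, fun u => ⟨0, 0, fun t => t.2.elim, fun t => t.2.elim, ?_⟩⟩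
    exact ⟨contDiff_const, contDiff_const, by simp, by simp⟩
  rw [Metric.dense_iff]
  intro F ε hε
  have huc : UniformContinuous (F.1 : I × C → ℝ) :=
    CompactSpace.uniformContinuous_of_continuous F.1.continuous
  obtain ⟨η, hη, hF⟩ := Metric.uniformContinuous_iff.1 huc (ε / 2) (half_pos hε)
  -- Samples used at time `t` will lie at most `2 / N` before `t`.
  obtain ⟨N, hN⟩ := exists_nat_gt (2 / η)
  have hN0 : (0 : ℝ) < N := (div_pos two_pos hη).trans hN
  have hNη : 2 / N < η := by rwa [div_lt_comm₀ hN0 hη]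
  obtain ⟨b, hb⟩ := hI.bddAbove
  obtain ⟨n, hn⟩ := exists_nat_gt (N * b)
  -- The shift by `-1` is the delay: node `i + 1`, approached from time `i / N` on, uses the first
  -- point of `I` at or after `i / N`. If there is no such point, the choice is arbitrary and
  -- harmless, since the transition to that node has not begun at any time of `I`.
  choose σ hσ using fun i : ℕ => exists_next_mem hI hne (((i : ℝ) - 1) / N)
  have h0 (t : I) : (0 : ℝ) ≤ t := hI0 t.2
  let G : C(I × C, ℝ) :=
    ⟨fun p => sineInterpolation n (fun i => F.1 (σ i, p.2)) (N * p.1), by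
      unfold sineInterpolation
      have := continuous_sineTransition
      fun_prop⟩
  have hGc : IsCausal (G : I × C → ℝ) := by
    intro t u v huv
    have hle (i : ℕ) (hi : ((i : ℝ) - 1) / N ≤ t) : F.1 (σ i, u) = F.1 (σ i, v) :=
      F.2 _ u v fun τ hτ => huv τ (hτ.trans (hσ i t hi).2)
    change sineInterpolation n (fun i => F.1 (σ i, u)) (N * t) =
      sineInterpolation n (fun i => F.1 (σ i, v)) (N * t)
    unfold sineInterpolation
    congr 1
    · refine hle 0 (le_trans ?_ (h0 t))
      exact div_nonpos_of_nonpos_of_nonneg (by simp) hN0.le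
    · refine Finset.sum_congr rfl fun i _ => ?_
      -- A term is either still zero or both its samples were taken by time `t`.
      rcases le_or_gt ((N : ℝ) * t) i with h | h
      · simp [sineTransition_of_nonpos (sub_nonpos.2 h)]
      · simp only
        rw [hle i, hle (i + 1)]
        · rw [div_le_iff₀ hN0]
          push_cast
          linarith
        · rw [div_le_iff₀ hN0]
          linarith
  refine ⟨⟨G, hGc⟩, ?_, 3, 0, sineEquation (N * π), fun u => ?_⟩
  · rw [Metric.mem_ball]
    change dist G F.1 < ε
    rw [ContinuousMap.dist_lt_iff hε]
    rintro ⟨t, u⟩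
    set k := ⌊(N : ℝ) * t⌋₊
    have hk : (k : ℝ) ≤ N * t := Nat.floor_le (mul_nonneg hN0.le (h0 t))
    have hk' : (N : ℝ) * t < k + 1 := Nat.lt_floor_add_one _
    have hkn : k < n := by
      have : (k : ℝ) < n :=
        (hk.trans (mul_le_mul_of_nonneg_left (hb t.2) hN0.le)).trans_lt hn
      exact_mod_cast this
    have hclose (i : ℕ) (hi : (i : ℝ) - 1 ≤ N * t) (hi' : (k : ℝ) ≤ i) :
        dist (F.1 (σ i, u)) (F.1 (t, u)) < ε / 2 := by
      apply hF
      obtain ⟨h1, h2⟩ := hσ i t (by rwa [div_le_iff₀' hN0])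
      have h2' : ((σ i : I) : ℝ) ≤ t := h2
      rw [Prod.dist_eq, dist_self, max_lt_iff]
      refine ⟨?_, hη⟩
      rw [Subtype.dist_eq, Real.dist_eq, abs_sub_comm, abs_of_nonneg (sub_nonneg.2 h2')]
      refine lt_of_le_of_lt ?_ hNη
      rw [le_div_iff₀' hN0]
      rw [div_le_iff₀' hN0] at h1
      linarith
    have h1 := hclose k (by linarith) le_rfl
    have h2 := hclose (k + 1) (by push_cast; linarith) (by simp)
    change dist (sineInterpolation n (fun i => F.1 (σ i, u)) (N * t)) _ < ε
    rw [sineInterpolation_eq n _ hkn hk hk'.le]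
    obtain ⟨h3, h4⟩ := sineTransition_mem_Icc (N * t - k)
    rw [Real.dist_eq] at h1 h2 ⊢
    rw [abs_lt] at h1 h2 ⊢
    generalize sineTransition (N * t - k) = τ at *
    -- The value is a convex combination of two samples, each within `ε / 2` of `F(t, u)`.
    constructor <;> nlinarith
  -- A Tietze extension of the input suffices, as no derivative of `u` occurs.
  · obtain ⟨v, hv⟩ := ContinuousMap.exists_restrict_eq hI.isClosed u.1
    refine ⟨fun t => sineInterpolation n (fun i => F.1 (σ i, u)) (N * t), v, fun t => rfl,
      fun t => ?_, isTrajectory_sineEquation hN0.ne' n _ _ v.continuous⟩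
    rw [← hv]
    rfl
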